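/- Let $d\ge 1$ and, for $i=1,\dots,d$, let $1<\alpha_i<2$ and $d_{i,+},d_{i,-}\ge 0$. For real $a_i<b_i$, integers $n_i\ge 1$, a final time $T>0$ and a number $M\ge 1$ of time steps, put $n=n_1\cdots n_d$, $\tau=T/M$, $\nu=1/\tau$, $h_i=(b_i-a_i)/(n_i+1)$, $v_{i,\pm}=d_{i,\pm}/(2h_i^{\alpha_i})$. Let $g_0^{(\alpha)}=1$, $g_k^{(\alpha)}=\bigl(1-\frac{\alpha+1}{k}\bigr)g_{k-1}^{(\alpha)}$, $w_0^{(\alpha)}=\frac{\alpha}{2}g_0^{(\alpha)}$, $w_k^{(\alpha)}=\frac{\alpha}{2}g_k^{(\alpha)}+\frac{2-\alpha}{2}g_{k-1}^{(\alpha)}$ for $k\ge1$, and let $L_m^{(\alpha)}\in\mathbb R^{m\times m}$ be the Toeplitz matrix whose $(p,q)$ entry is $-w_{p-q+1}^{(\alpha)}$ if $p-q+1\ge 0$ and $0$ otherwise. Define the matrix of the second-order (Crank–Nicolson, weighted and shifted Grünwald) scheme by $$A_n=\nu I_n+\sum_{i=1}^d\bigl(v_{i,+}W_i+v_{i,-}W_i^{\top}\bigr),\qquad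 W_i=I_{n_1\cdots n_{i-1}}\otimes L_{n_i}^{(\alpha_i)}\otimes I_{n_{i+1}\cdots n_d},$$ let $\mathcal H(A_n)=(A_n+A_n^{\top})/2$, and let $Y_n=Y_{n_1}\otimes\cdots\otimes Y_{n_d}$, where $Y_m$ is the $m\times m$ anti-identity matrix. Put $$\mu=\max_{1\le i\le d}\frac{|d_{i,+}-d_{i,-}|}{d_{i,+}+d_{i,-}}\left|\tan\left(\frac{\alpha_i}{2}\pi\right)\right|,$$ where the term of an index with $d_{i,+}=d_{i,-}=0$ is read as $0$. Then there is a number $\varepsilon\ge 0$, depending only on $d$ and the $\alpha_i$, $d_{i,\pm}$ (not on the $n_i$, $a_i$, $b_i$, $T$, $M$), with $\varepsilon<\mu$ if $\mu>0$ and $\varepsilon=0$ if $\mu=0$, such that for all $a_i<b_i$, $n_i\ge1$, $T>0$, $M\ge1$ the matrix $\mathcal H(A_n)$ is invertible and all (complex) eigenvalues of $\mathcal H(A_n)^{-1}Y_nA_n$ are real and lie in $[-(1+\varepsilon),-1]\cup[1,1+\varepsilon]$. -/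

import Mathlib

noncomputable section

namespace FracDiff

/-- Grünwald coefficients: `g 0 = 1`, `g k = (1 - (α + 1) / k) * g (k - 1)` for `k ≥ 1`. -/
def grunwald (α : ℝ) : ℕ → ℝ
  | 0 => 1
  | k + 1 => (1 - (α + 1) / ((k : ℝ) + 1)) * grunwald α k

/-- Coefficients of the weighted and shifted Grünwald scheme. -/
def wCoeff (α : ℝ) : ℕ → ℝ
  | 0 => α / 2 * grunwald α 0
  | k + 1 => α / 2 * grunwald α (k + 1) + (2 - α) / 2 * grunwald α k

/-- The `m × m` lower Hessenberg Toeplitz matrix with `(p, q)` entry `-w_{p - q + 1}`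
if `p - q + 1 ≥ 0` and `0` otherwise. -/
def grunwaldMatrix (α : ℝ) (m : ℕ) : Matrix (Fin m) (Fin m) ℝ :=
  Matrix.of fun p q =>
    if (q : ℕ) ≤ (p : ℕ) + 1 then -wCoeff α ((p : ℕ) + 1 - (q : ℕ)) else 0

/-- The `m × m` anti-identity (flip) matrix. -/
def flipMatrix (m : ℕ) : Matrix (Fin m) (Fin m) ℝ :=
  Matrix.of fun p q => if (p : ℕ) + (q : ℕ) + 1 = m then 1 else 0

/-- Multi-indices `(p_1, …, p_d)` with `p_i` in a set of size `n_i`. They index the rows and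
columns of an `n × n` matrix, `n = n_1 ⋯ n_d`. -/
abbrev MultiIndex {d : ℕ} (n : Fin d → ℕ) : Type := (i : Fin d) → Fin (n i)

/-- The Kronecker product `M_1 ⊗ ⋯ ⊗ M_d` of square matrices, indexed by multi-indices. -/
def kron {d : ℕ} {n : Fin d → ℕ} (M : (i : Fin d) → Matrix (Fin (n i)) (Fin (n i)) ℝ) :
    Matrix (MultiIndex n) (MultiIndex n) ℝ :=
  Matrix.of fun p q => ∏ i, M i (p i) (q i)

/-- `I ⊗ ⋯ ⊗ I ⊗ B ⊗ I ⊗ ⋯ ⊗ I` with `B` as the `i`-th factor. -/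
def kronAt {d : ℕ} {n : Fin d → ℕ} (i : Fin d) (B : Matrix (Fin (n i)) (Fin (n i)) ℝ) :
    Matrix (MultiIndex n) (MultiIndex n) ℝ :=
  kron (Function.update (fun _ => 1) i B)

/-- The multilevel flip matrix `Y_{n_1} ⊗ ⋯ ⊗ Y_{n_d}`. -/
def multiFlip {d : ℕ} (n : Fin d → ℕ) : Matrix (MultiIndex n) (MultiIndex n) ℝ :=
  kron fun i => flipMatrix (n i)

/-- Spatial step size on `(a, b)` with `m` interior grid points. -/
def stepSize (a b : ℝ) (m : ℕ) : ℝ := (b - a) / ((m : ℝ) + 1)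

/-- The coefficient matrix
`ν I + ∑ i, (v_{i,+} W_i + v_{i,-} W_iᵀ)`, `ν = 1 / τ`, `v_{i,±} = d_{i,±} / (2 h_i ^ α_i)`,
`W_i = I ⊗ L_{n_i}^{(α_i)} ⊗ I`, of the Crank–Nicolson scheme in time with the weighted and
shifted Grünwald scheme in space. -/
def schemeMatrix {d : ℕ} (α dPlus dMinus a b : Fin d → ℝ) (τ : ℝ) (n : Fin d → ℕ) :
    Matrix (MultiIndex n) (MultiIndex n) ℝ :=
  (1 / τ) • (1 : Matrix (MultiIndex n) (MultiIndex n) ℝ) +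
    ∑ i, ((dPlus i / (2 * stepSize (a i) (b i) (n i) ^ α i)) •
            kronAt i (grunwaldMatrix (α i) (n i)) +
          (dMinus i / (2 * stepSize (a i) (b i) (n i) ^ α i)) •
            (kronAt i (grunwaldMatrix (α i) (n i))).transpose)

/-- The symmetric part `(A + Aᵀ) / 2`. -/
def symPart {ι : Type*} (A : Matrix ι ι ℝ) : Matrix ι ι ℝ :=
  (1 / 2 : ℝ) • (A + A.transpose)

/-- `max_i |d_{i,+} - d_{i,-}| / (d_{i,+} + d_{i,-}) * |tan (α_i π / 2)|`; the term of an index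
with `d_{i,+} = d_{i,-} = 0` counts as `0`. -/
def skewBound {d : ℕ} [NeZero d] (α dPlus dMinus : Fin d → ℝ) : ℝ :=
  Finset.univ.sup' Finset.univ_nonempty fun i : Fin d =>
    |dPlus i - dMinus i| / (dPlus i + dMinus i) * |Real.tan (α i / 2 * Real.pi)|

end FracDiff

end

/-!
On the unit circle the symbol of `L_m^{(α)}` takes values in the sector
`|Im z| ≤ |tan (α π / 2)| Re z`, hence so does the numerical range of this Toeplitz matrix.
Kronecker products with identities preserve this, and combining `W` with `Wᵀ` with weights `p, q`
multiplies the slope by `|p - q| / (p + q)`, so the numerical range of `A` lies in the sector of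
slope `μ`, with `H = ℋ(A)` positive definite. Write `A = H + S` with `S` skew-symmetric. Since
`Y A Y = Aᵀ` and `Y² = 1`, one has `(H⁻¹ Y A)² = 1 - (H⁻¹ S)²`. The eigenvalues of the pencil
`(S, H)` are `i s` with `s` real, and the sector gives `|s| ≤ μ`; thus the eigenvalues of
`H⁻¹ Y A` are `± √(1 + s²)`, and `ε = √(1 + μ²) - 1` works.
-/

noncomputable section

namespace FracDiff

open Filter Matrix MeasureTheory Polynomial
open scoped ComplexOrder ComplexStarModule Topology

section Sector

variable {s t : ℝ} {z : ℂ}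

/-- The closed convex sector `{z | |im z| ≤ t * re z}` of the right half-plane. The condition
`0 ≤ re z` is automatic for `0 < t`, and makes `sector 0` the half-line of nonnegative reals. -/
def sector (t : ℝ) : PointedCone ℝ ℂ where
  carrier := {z | 0 ≤ z.re ∧ |z.im| ≤ t * z.re}
  add_mem' {z w} hz hw := ⟨add_nonneg hz.1 hw.1, by
    rw [Complex.add_im, Complex.add_re, mul_add]
    exact (abs_add_le _ _).trans (add_le_add hz.2 hw.2)⟩
  zero_mem' := by simp
  smul_mem' c z hz := by
    have him : (c • z).im = c * z.im := Complex.smul_im (c : ℝ) z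
    have hre : (c • z).re = c * z.re := Complex.smul_re (c : ℝ) z
    rw [Set.mem_ofPred_eq, him, hre, abs_mul, abs_of_nonneg c.2, mul_left_comm]
    exact ⟨mul_nonneg c.2 hz.1, mul_le_mul_of_nonneg_left hz.2 c.2⟩

theorem mem_sector : z ∈ sector t ↔ 0 ≤ z.re ∧ |z.im| ≤ t * z.re := Iff.rfl

theorem sector_mono (hst : s ≤ t) : sector s ≤ sector t := fun _ hz =>
  ⟨hz.1, hz.2.trans (mul_le_mul_of_nonneg_right hst hz.1)⟩

theorem ofReal_mem_sector (ht : 0 ≤ t) {r : ℝ} (hr : 0 ≤ r) : (r : ℂ) ∈ sector t := by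
  simpa [mem_sector, hr] using mul_nonneg ht hr

theorem smul_add_smul_star_mem_sector {p q : ℝ} (hp : 0 ≤ p) (hq : 0 ≤ q) (hz : z ∈ sector t) :
    p • z + q • star z ∈ sector (|p - q| / (p + q) * t) := by
  have hre : (p • z + q • star z).re = (p + q) * z.re := by
    simp only [Complex.real_smul, Complex.star_def, Complex.add_re, Complex.re_ofReal_mul,
      Complex.conj_re]
    ring
  have him : (p • z + q • star z).im = (p - q) * z.im := by
    simp only [Complex.real_smul, Complex.star_def, Complex.add_im, Complex.im_ofReal_mul,
      Complex.conj_im]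
    ring
  rw [mem_sector, hre, him, abs_mul]
  refine ⟨mul_nonneg (add_nonneg hp hq) hz.1, ?_⟩
  obtain hpq | hpq := (add_nonneg hp hq).eq_or_lt
  · obtain ⟨rfl, rfl⟩ := (add_eq_zero_iff_of_nonneg hp hq).1 hpq.symm
    simp
  · calc |p - q| * |z.im| ≤ |p - q| * (t * z.re) :=
          mul_le_mul_of_nonneg_left hz.2 (abs_nonneg _)
      _ = |p - q| / (p + q) * t * ((p + q) * z.re) := by field_simp

theorem integral_mem_sector {X : Type*} {mX : MeasurableSpace X} {ν : Measure X} {f : X → ℂ}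
    (hf : Integrable f ν) (hft : ∀ᵐ x ∂ν, f x ∈ sector t) : ∫ x, f x ∂ν ∈ sector t := by
  have hre : (∫ x, f x ∂ν).re = ∫ x, (f x).re ∂ν := (integral_re hf).symm
  have him : (∫ x, f x ∂ν).im = ∫ x, (f x).im ∂ν := (integral_im hf).symm
  rw [mem_sector, hre, him, ← integral_const_mul]
  exact ⟨integral_nonneg_of_ae (hft.mono fun _ h => h.1),
    (abs_integral_le_integral_abs).trans
      (integral_mono_ae hf.im.abs (hf.re.const_mul t) (hft.mono fun _ h => h.2))⟩

end Sector

section Sectorial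

variable {ι κ : Type*} [Fintype ι] [Fintype κ] {A : Matrix ι ι ℂ} {s t : ℝ}

/-- The cone of complex matrices whose numerical range lies in `sector t`. -/
def sectorial (t : ℝ) : PointedCone ℝ (Matrix ι ι ℂ) where
  carrier := {A | ∀ x, star x ⬝ᵥ A *ᵥ x ∈ sector t}
  add_mem' hA hB x := by
    rw [add_mulVec, dotProduct_add]
    exact add_mem (hA x) (hB x)
  zero_mem' x := by simp
  smul_mem' c A hA x := by
    have hx : star x ⬝ᵥ (c • A) *ᵥ x = c • (star x ⬝ᵥ A *ᵥ x) := by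
      rw [smul_mulVec, dotProduct_smul]
    rw [hx]
    exact Submodule.smul_mem _ c (hA x)

theorem sectorial_mono (hst : s ≤ t) : (sectorial s : PointedCone ℝ (Matrix ι ι ℂ)) ≤ sectorial t :=
  fun _ hA x => sector_mono hst (hA x)

theorem star_dotProduct_conjTranspose_mulVec (A : Matrix ι ι ℂ) (x : ι → ℂ) :
    star x ⬝ᵥ Aᴴ *ᵥ x = star (star x ⬝ᵥ A *ᵥ x) := by
  rw [star_dotProduct, star_mulVec, conjTranspose_conjTranspose, dotProduct_mulVec]

theorem smul_add_smul_conjTranspose_mem_sectorial {p q : ℝ} (hp : 0 ≤ p) (hq : 0 ≤ q)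
    (hA : A ∈ sectorial t) : p • A + q • Aᴴ ∈ sectorial (|p - q| / (p + q) * t) := fun x => by
  rw [add_mulVec, dotProduct_add, smul_mulVec, smul_mulVec, dotProduct_smul, dotProduct_smul,
    star_dotProduct_conjTranspose_mulVec]
  exact smul_add_smul_star_mem_sector hp hq (hA x)

theorem submatrix_mem_sectorial (e : κ ≃ ι) (hA : A ∈ sectorial t) :
    A.submatrix e e ∈ sectorial t := fun x => by
  rw [submatrix_mulVec_equiv, ← comp_equiv_symm_dotProduct]
  exact hA (x ∘ e.symm)

theorem blockDiagonal_mem_sectorial [DecidableEq κ] {M : κ → Matrix ι ι ℂ}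
    (hM : ∀ k, M k ∈ sectorial t) : blockDiagonal M ∈ sectorial t := fun x => by
  have hMx : ∀ i k, (blockDiagonal M *ᵥ x) (i, k) = (M k *ᵥ fun j => x (j, k)) i := fun i k => by
    simp [mulVec, dotProduct, Fintype.sum_prod_type, blockDiagonal_apply]
  have hx : star x ⬝ᵥ blockDiagonal M *ᵥ x =
      ∑ k, star (fun i => x (i, k)) ⬝ᵥ M k *ᵥ fun i => x (i, k) := by
    simp only [dotProduct, Fintype.sum_prod_type_right, hMx, Pi.star_apply]
  rw [hx]
  exact sum_mem fun k _ => hM k _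

theorem star_dotProduct_realPart_mulVec (A : Matrix ι ι ℂ) (x : ι → ℂ) :
    star x ⬝ᵥ (ℜ A : Matrix ι ι ℂ) *ᵥ x = (star x ⬝ᵥ A *ᵥ x).re := by
  rw [realPart_apply_coe, smul_mulVec, dotProduct_smul, add_mulVec, dotProduct_add,
    star_eq_conjTranspose, star_dotProduct_conjTranspose_mulVec, Complex.re_eq_add_conj,
    Complex.star_def, Complex.real_smul]
  push_cast
  ring

theorem star_dotProduct_imaginaryPart_mulVec (A : Matrix ι ι ℂ) (x : ι → ℂ) :
    star x ⬝ᵥ (ℑ A : Matrix ι ι ℂ) *ᵥ x = (star x ⬝ᵥ A *ᵥ x).im := by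
  have hA : star x ⬝ᵥ A *ᵥ x = star x ⬝ᵥ (ℜ A : Matrix ι ι ℂ) *ᵥ x +
      Complex.I * (star x ⬝ᵥ (ℑ A : Matrix ι ι ℂ) *ᵥ x) := by
    conv_lhs => rw [← realPart_add_I_smul_imaginaryPart A]
    rw [add_mulVec, dotProduct_add, smul_mulVec, dotProduct_smul, smul_eq_mul]
  rw [star_dotProduct_realPart_mulVec] at hA
  refine mul_left_cancel₀ Complex.I_ne_zero ?_
  linear_combination -hA + (Complex.re_add_im (star x ⬝ᵥ A *ᵥ x)).symm

theorem posSemidef_realPart_of_mem_sectorial (hA : A ∈ sectorial t) :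
    (ℜ A : Matrix ι ι ℂ).PosSemidef :=
  .of_dotProduct_mulVec_nonneg (ℜ A).2 fun x => by
    rw [star_dotProduct_realPart_mulVec]
    exact_mod_cast (hA x).1

theorem one_mem_sectorial [DecidableEq ι] (ht : 0 ≤ t) : (1 : Matrix ι ι ℂ) ∈ sectorial t :=
  fun x => by
    have hx : star x ⬝ᵥ (1 : Matrix ι ι ℂ) *ᵥ x = (∑ i, ‖x i‖ ^ 2 : ℝ) := by
      simp [dotProduct, Complex.conj_mul']
    rw [hx]
    exact ofReal_mem_sector ht (by positivity)

end Sectorial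

section Spectrum

variable {ι : Type*} [Fintype ι] [DecidableEq ι] {A Y : Matrix ι ι ℂ} {t : ℝ} {μ : ℂ}

theorem exists_real_of_hasEigenvalue_inv_realPart_mul_imaginaryPart
    (hH : (ℜ A : Matrix ι ι ℂ).PosDef) (hA : A ∈ sectorial t)
    (hμ : Module.End.HasEigenvalue
      (toLin' ((ℜ A : Matrix ι ι ℂ)⁻¹ * (ℑ A : Matrix ι ι ℂ))) μ) :
    ∃ s : ℝ, μ = s ∧ |s| ≤ t := by
  obtain ⟨v, hv, hv0⟩ := hμ.exists_hasEigenvector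
  rw [Module.End.mem_eigenspace_iff, toLin'_apply] at hv
  have hSv : (ℑ A : Matrix ι ι ℂ) *ᵥ v = μ • (ℜ A : Matrix ι ι ℂ) *ᵥ v := by
    rw [← mulVec_smul, ← hv, mulVec_mulVec, mul_nonsing_inv_cancel_left _ _
      ((isUnit_iff_isUnit_det _).1 hH.isUnit)]
  set w := star v ⬝ᵥ A *ᵥ v
  have him : (w.im : ℂ) = μ * w.re := by
    rw [← star_dotProduct_imaginaryPart_mulVec, ← star_dotProduct_realPart_mulVec, hSv,
      dotProduct_smul, smul_eq_mul]
  have hre : 0 < w.re := by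
    have := hH.dotProduct_mulVec_pos hv0
    rw [star_dotProduct_realPart_mulVec] at this
    exact_mod_cast this
  refine ⟨w.im / w.re, ?_, ?_⟩
  · rw [Complex.ofReal_div, him, mul_div_cancel_right₀ _ (by exact_mod_cast hre.ne')]
  · rw [abs_div, abs_of_pos hre, div_le_iff₀ hre]
    exact (hA v).2

theorem inv_realPart_mul_flip_mul_sq (hH : IsUnit (ℜ A : Matrix ι ι ℂ).det) (hY : Y * Y = 1)
    (hYA : Y * A * Y = Aᴴ) :
    ((ℜ A : Matrix ι ι ℂ)⁻¹ * (Y * A)) ^ 2 =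
      1 + ((ℜ A : Matrix ι ι ℂ)⁻¹ * (ℑ A : Matrix ι ι ℂ)) ^ 2 := by
  have hAY : Y * A = Aᴴ * Y := by rw [← hYA, mul_assoc, hY, mul_one]
  have hAY' : Y * Aᴴ = A * Y := by rw [← hYA, ← mul_assoc, ← mul_assoc, hY, one_mul]
  have hHY : Commute (ℜ A : Matrix ι ι ℂ) Y := by
    rw [commute_iff_eq, realPart_apply_coe, smul_mul_assoc, mul_smul_comm, add_mul, mul_add,
      star_eq_conjTranspose, hAY, hAY', add_comm]
  have hA := realPart_add_I_smul_imaginaryPart A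
  have hA' : Aᴴ = ℜ A - Complex.I • (ℑ A : Matrix ι ι ℂ) := by
    conv_lhs => rw [← hA]
    rw [conjTranspose_add, conjTranspose_smul, ← star_eq_conjTranspose, ← star_eq_conjTranspose,
      (ℜ A).2.star_eq, (ℑ A).2.star_eq, Complex.star_def, Complex.conj_I, neg_smul,
      sub_eq_add_neg]
  generalize (ℜ A : Matrix ι ι ℂ) = H at *
  generalize (ℑ A : Matrix ι ι ℂ) = S at *
  have hHY' : Y * H⁻¹ = H⁻¹ * Y := by
    simpa only [Matrix.zpow_neg_one] using (Matrix.Commute.zpow_right hHY.symm (-1)).eq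
  calc (H⁻¹ * (Y * A)) ^ 2 = H⁻¹ * Aᴴ * (Y * H⁻¹) * (Y * A) := by
        rw [sq, hAY]; simp only [mul_assoc]
    _ = (H⁻¹ * Aᴴ) * (H⁻¹ * A) := by
        rw [hHY']
        simp only [mul_assoc]
        rw [← mul_assoc Y Y, hY, one_mul]
    _ = (1 - Complex.I • (H⁻¹ * S)) * (1 + Complex.I • (H⁻¹ * S)) := by
        rw [hA', ← hA, mul_sub, mul_add, nonsing_inv_mul _ hH, mul_smul_comm]
    _ = 1 + (H⁻¹ * S) ^ 2 := by
        rw [sq, sub_mul, mul_add, mul_add, one_mul, mul_one, one_mul, smul_mul_smul_comm,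
          Complex.I_mul_I, neg_smul, one_smul]
        abel

theorem exists_real_of_sq_eq_one_add_sq {s : ℝ} (hs : |s| ≤ t) (h : μ ^ 2 = 1 + (s : ℂ) ^ 2) :
    ∃ x : ℝ, μ = x ∧ x ∈ Set.Icc (-√(1 + t ^ 2)) (-1) ∪ Set.Icc 1 √(1 + t ^ 2) := by
  have hsq : μ ^ 2 = (√(1 + s ^ 2) : ℂ) ^ 2 := by
    rw [h, ← Complex.ofReal_pow √(1 + s ^ 2), Real.sq_sqrt (by positivity)]
    push_cast
    rfl
  have h1 : 1 ≤ √(1 + s ^ 2) := Real.one_le_sqrt.2 (by nlinarith)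
  have h2 : √(1 + s ^ 2) ≤ √(1 + t ^ 2) :=
    Real.sqrt_le_sqrt (add_le_add_right (sq_le_sq.2 (hs.trans (le_abs_self t))) 1)
  obtain hμ | hμ := sq_eq_sq_iff_eq_or_eq_neg.1 hsq
  · exact ⟨_, hμ, .inr ⟨h1, h2⟩⟩
  · exact ⟨-√(1 + s ^ 2), by rw [hμ, Complex.ofReal_neg],
      .inl ⟨neg_le_neg h2, neg_le_neg h1⟩⟩

theorem exists_real_of_hasEigenvalue_inv_realPart_mul_flip_mul
    (hH : (ℜ A : Matrix ι ι ℂ).PosDef) (hA : A ∈ sectorial t) (hY : Y * Y = 1)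
    (hYA : Y * A * Y = Aᴴ)
    (hμ : Module.End.HasEigenvalue (toLin' ((ℜ A : Matrix ι ι ℂ)⁻¹ * (Y * A))) μ) :
    ∃ x : ℝ, μ = x ∧ x ∈ Set.Icc (-√(1 + t ^ 2)) (-1) ∪ Set.Icc 1 √(1 + t ^ 2) := by
  set K := (ℜ A : Matrix ι ι ℂ)⁻¹ * (ℑ A : Matrix ι ι ℂ) with hK
  have hsq : ((ℜ A : Matrix ι ι ℂ)⁻¹ * (Y * A)) ^ 2 = Polynomial.aeval K (1 + X ^ 2 : ℂ[X]) := by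
    rw [inv_realPart_mul_flip_mul_sq ((isUnit_iff_isUnit_det _).1 hH.isUnit) hY hYA]
    simp [hK]
  have hdeg : 0 < (1 + X ^ 2 : ℂ[X]).degree := by
    rw [show (1 + X ^ 2 : ℂ[X]).degree = 2 by compute_degree!]
    norm_num
  rw [Module.End.hasEigenvalue_iff_mem_spectrum, spectrum_toLin'] at hμ
  have hμ2 := spectrum.pow_mem_pow _ 2 hμ
  rw [hsq, spectrum.map_polynomial_aeval_of_degree_pos _ _ hdeg] at hμ2
  obtain ⟨κ, hκ, hκμ⟩ := hμ2
  rw [← spectrum_toLin', ← Module.End.hasEigenvalue_iff_mem_spectrum] at hκ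
  obtain ⟨s, rfl, hs⟩ :=
    exists_real_of_hasEigenvalue_inv_realPart_mul_imaginaryPart hH hA hκ
  exact exists_real_of_sq_eq_one_add_sq hs (by simpa using hκμ.symm)

end Spectrum

section Complexify

variable {ι : Type*} [Fintype ι] [DecidableEq ι] {A Y : Matrix ι ι ℝ} {t : ℝ} {μ : ℂ}

/-- The entrywise inclusion of real matrices into complex matrices. -/
def complexify : Matrix ι ι ℝ →ₐ[ℝ] Matrix ι ι ℂ := Complex.ofRealAm.mapMatrix

theorem complexify_apply (A : Matrix ι ι ℝ) (i j : ι) : complexify A i j = A i j := rfl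

theorem complexify_transpose (A : Matrix ι ι ℝ) : complexify Aᵀ = (complexify A)ᴴ := by
  ext i j
  simp [complexify_apply]

theorem complexify_symPart (A : Matrix ι ι ℝ) :
    complexify (symPart A) = (ℜ (complexify A) : Matrix ι ι ℂ) := by
  rw [realPart_apply_coe, symPart, map_smul, map_add, complexify_transpose, one_div,
    star_eq_conjTranspose]

theorem isUnit_det_symPart (hA : (ℜ (complexify A) : Matrix ι ι ℂ).PosDef) :
    IsUnit (symPart A).det := by
  have h := (isUnit_iff_isUnit_det _).1 hA.isUnit
  rw [← complexify_symPart, complexify, ← AlgHom.map_det] at h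
  exact isUnit_of_map_unit _ _ h

theorem complexify_inv (hA : IsUnit A.det) : complexify A⁻¹ = (complexify A)⁻¹ :=
  (inv_eq_right_inv (by rw [← map_mul, mul_nonsing_inv _ hA, map_one])).symm

theorem exists_real_of_hasEigenvalue_inv_symPart_mul_flip_mul
    (hH : (ℜ (complexify A) : Matrix ι ι ℂ).PosDef) (hA : complexify A ∈ sectorial t)
    (hY : Y * Y = 1) (hYA : Y * A * Y = Aᵀ)
    (hμ : Module.End.HasEigenvalue (toLin' (complexify ((symPart A)⁻¹ * (Y * A)))) μ) :
    ∃ x : ℝ, μ = x ∧ x ∈ Set.Icc (-√(1 + t ^ 2)) (-1) ∪ Set.Icc 1 √(1 + t ^ 2) := by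
  rw [map_mul complexify, map_mul complexify, complexify_inv (isUnit_det_symPart hH),
    complexify_symPart] at hμ
  refine exists_real_of_hasEigenvalue_inv_realPart_mul_flip_mul hH hA ?_ ?_ hμ
  · rw [← map_mul, hY, map_one]
  · rw [← map_mul, ← map_mul, hYA, complexify_transpose]

end Complexify

section Grunwald

variable {α : ℝ} {z : ℂ}

theorem choose_succ_mul (a : ℂ) (k : ℕ) :
    Ring.choose a (k + 1) * (k + 1) = Ring.choose a k * (a - k) := by
  have hk : (k : ℂ) + 1 ≠ 0 := k.cast_add_one_ne_zero
  have hf : (k.factorial : ℂ) ≠ 0 := by exact_mod_cast k.factorial_ne_zero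
  rw [Ring.choose_eq_smul, Ring.choose_eq_smul, descPochhammer_succ_right, Polynomial.smeval_mul,
    Polynomial.smeval_sub, Polynomial.smeval_X, Polynomial.smeval_natCast, Nat.factorial_succ]
  simp only [smul_eq_mul, pow_one, pow_zero, nsmul_eq_mul, mul_one]
  push_cast
  field_simp

theorem ofReal_grunwald (α : ℝ) (k : ℕ) :
    (grunwald α k : ℂ) = (-1) ^ k * Ring.choose (α : ℂ) k := by
  induction k with
  | zero => simp [grunwald]
  | succ k ih =>
    have hk : (k : ℂ) + 1 ≠ 0 := k.cast_add_one_ne_zero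
    rw [grunwald, ← mul_left_inj' hk, mul_assoc ((-1) ^ (k + 1)), choose_succ_mul]
    push_cast
    rw [ih]
    field_simp
    ring

theorem hasSum_grunwald_mul_pow_of_norm_lt_one (α : ℝ) (hz : ‖z‖ < 1) :
    HasSum (fun k => (grunwald α k : ℂ) * z ^ k) ((1 - z) ^ (α : ℂ)) := by
  have h := (Complex.one_add_cpow_hasFPowerSeriesOnBall_zero (a := (α : ℂ))).hasSum
    (y := -z) (by simpa [enorm_eq_nnnorm, ← NNReal.coe_lt_one] using hz)
  simp only [binomialSeries_apply, zero_add, List.ofFn_const, List.prod_replicate,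
    smul_eq_mul] at h
  rw [sub_eq_add_neg]
  refine h.congr_fun fun k => ?_
  rw [ofReal_grunwald, neg_pow z]
  ring

theorem sum_range_succ_grunwald (hα : α ≠ 0) (n : ℕ) :
    ∑ k ∈ Finset.range (n + 1), grunwald α k = -((n + 1) * grunwald α (n + 1)) / α := by
  induction n with
  | zero => simp [grunwald, hα]
  | succ n ih =>
    have hn : (n : ℝ) + 1 + 1 ≠ 0 := by positivity
    rw [Finset.sum_range_succ, ih, grunwald.eq_2 α (n + 1)]
    push_cast
    field_simp
    ring

theorem grunwald_add_two_nonneg (h1 : 1 ≤ α) (h2 : α ≤ 2) (k : ℕ) :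
    0 ≤ grunwald α (k + 2) := by
  induction k with
  | zero =>
    have htwo : grunwald α 2 = α * (α - 1) / 2 := by
      simp only [grunwald]
      push_cast
      ring
    rw [htwo]
    exact div_nonneg (mul_nonneg (by linarith) (by linarith)) two_pos.le
  | succ k ih =>
    refine mul_nonneg (sub_nonneg.2 ((div_le_one (by positivity)).2 ?_)) ih
    push_cast
    linarith [k.cast_nonneg (α := ℝ)]

theorem summable_abs_grunwald (h1 : 1 ≤ α) (h2 : α ≤ 2) : Summable fun k => |grunwald α k| := by
  rw [← summable_nat_add_iff 2]
  refine summable_of_sum_range_le (c := α - 1) (fun _ => abs_nonneg _) fun n => ?_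
  simp only [abs_of_nonneg (grunwald_add_two_nonneg h1 h2 _)]
  have hsum : ∑ k ∈ Finset.range (n + 2), grunwald α k ≤ 0 := by
    rw [sum_range_succ_grunwald (by linarith) (n + 1)]
    exact div_nonpos_of_nonpos_of_nonneg
      (neg_nonpos.2 (mul_nonneg (by positivity) (grunwald_add_two_nonneg h1 h2 n))) (by linarith)
  have hzero : grunwald α 0 = 1 := rfl
  have hone : grunwald α 1 = -α := by simp [grunwald]
  rw [Finset.sum_range_succ', Finset.sum_range_succ', zero_add, hzero, hone] at hsum
  linarith

theorem norm_ofReal_mul_pow_le (r : ℝ) (hz : ‖z‖ ≤ 1) (k : ℕ) : ‖(r : ℂ) * z ^ k‖ ≤ |r| := by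
  rw [norm_mul, norm_pow, Complex.norm_real, Real.norm_eq_abs]
  exact mul_le_of_le_one_right (abs_nonneg r) (pow_le_one₀ (norm_nonneg z) hz)

/- On the boundary circle the value of the binomial series is identified by Abel's theorem. -/
theorem hasSum_grunwald_mul_pow (h1 : 1 ≤ α) (h2 : α ≤ 2) (hz : ‖z‖ ≤ 1) :
    HasSum (fun k => (grunwald α k : ℂ) * z ^ k) ((1 - z) ^ (α : ℂ)) := by
  have hsum : Summable fun k => (grunwald α k : ℂ) * z ^ k :=
    .of_norm_bounded (summable_abs_grunwald h1 h2) fun k => norm_ofReal_mul_pow_le _ hz k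
  have habel := tendsto_map'_iff.1
    (Complex.tendsto_tsum_powerSeries_nhdsWithin_lt hsum.hasSum.tendsto_sum_nat)
  have hcont : Tendsto (fun r : ℝ => (1 - r * z) ^ (α : ℂ)) (𝓝[<] 1) (𝓝 ((1 - z) ^ (α : ℂ))) := by
    have hre : 0 ≤ (1 - z).re := by simpa using (Complex.re_le_norm z).trans hz
    have hpow : ContinuousAt (fun w : ℂ => w ^ (α : ℂ)) (1 - z) :=
      Complex.continuousAt_cpow_const_of_re_pos (.inl hre) (by simpa using by linarith)
    have hray : Tendsto (fun r : ℝ => 1 - r * z) (𝓝[<] 1) (𝓝 (1 - z)) := by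
      have : Continuous fun r : ℝ => 1 - r * z := by fun_prop
      simpa using (this.tendsto 1).mono_left nhdsWithin_le_nhds
    exact hpow.tendsto.comp hray
  have heq : ∀ᶠ r : ℝ in 𝓝[<] 1,
      ∑' k, (grunwald α k : ℂ) * z ^ k * (r : ℂ) ^ k = (1 - r * z) ^ (α : ℂ) := by
    filter_upwards [Ioo_mem_nhdsLT zero_lt_one] with r hr
    have hrz : ‖r * z‖ < 1 := by
      rw [norm_mul, Complex.norm_real, Real.norm_of_nonneg hr.1.le]
      exact (mul_le_of_le_one_right hr.1.le hz).trans_lt hr.2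
    rw [← (hasSum_grunwald_mul_pow_of_norm_lt_one α hrz).tsum_eq]
    exact tsum_congr fun k => by rw [mul_pow]; ring
  rw [← tendsto_nhds_unique (habel.congr' heq) hcont]
  exact hsum.hasSum

theorem summable_abs_wCoeff (h1 : 1 ≤ α) (h2 : α ≤ 2) : Summable fun k => |wCoeff α k| := by
  have hs := (summable_abs_grunwald h1 h2).of_abs
  rw [summable_abs_iff, ← summable_nat_add_iff 1]
  exact (((summable_nat_add_iff 1).2 hs).mul_left _).add (hs.mul_left _)

theorem hasSum_wCoeff_mul_pow (h1 : 1 ≤ α) (h2 : α ≤ 2) (hz : ‖z‖ ≤ 1) :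
    HasSum (fun k => (wCoeff α k : ℂ) * z ^ k)
      ((α / 2 + (2 - α) / 2 * z) * (1 - z) ^ (α : ℂ)) := by
  have h := hasSum_grunwald_mul_pow h1 h2 hz
  have h' := (hasSum_nat_add_iff' 1).2 h
  rw [← hasSum_nat_add_iff' 1]
  convert! (h'.mul_left ((α : ℂ) / 2)).add (h.mul_left ((2 - (α : ℂ)) / 2 * z)) using 1
  · funext k
    simp only [wCoeff]
    push_cast
    ring
  · simp only [wCoeff, grunwald, Finset.sum_range_one, pow_zero]
    push_cast
    ring

end Grunwald

section Symbol

open Real (cos sin tan)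

variable {α c : ℝ} {z : ℂ}

/-- The generating function `∑ k, -w_k z ^ (k - 1)` of the Toeplitz matrices
`grunwaldMatrix α m`, in closed form. -/
def symbol (α : ℝ) (z : ℂ) : ℂ := -(z⁻¹ * ((α / 2 + (2 - α) / 2 * z) * (1 - z) ^ (α : ℂ)))

theorem hasSum_symbol (h1 : 1 ≤ α) (h2 : α ≤ 2) (hz : ‖z‖ = 1) :
    HasSum (fun k : ℕ => -(wCoeff α k : ℂ) * z ^ ((k : ℤ) - 1)) (symbol α z) := by
  have hz0 : z ≠ 0 := norm_ne_zero_iff.1 (by simp [hz])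
  refine ((hasSum_wCoeff_mul_pow h1 h2 hz.le).mul_left z⁻¹).neg.congr_fun fun k => ?_
  rw [zpow_sub_one₀ hz0, zpow_natCast]
  ring

theorem norm_one_sub_sq_eq_two_mul_re (hz : ‖z‖ = 1) : ‖1 - z‖ ^ 2 = 2 * (1 - z).re := by
  have h := Complex.sq_norm z
  rw [hz, Complex.normSq_apply] at h
  rw [Complex.sq_norm, Complex.normSq_apply]
  simp only [Complex.sub_re, Complex.one_re, Complex.sub_im, Complex.one_im]
  linarith

theorem cpow_ofReal_eq_mul_exp_mul_exp (α : ℝ) (w : ℂ) :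
    w ^ (α : ℂ) = (‖w‖ ^ α : ℝ) * (Complex.exp (((α - 1) * w.arg : ℝ) * Complex.I) *
      Complex.exp (w.arg * Complex.I)) := by
  rw [Complex.cpow_ofReal, ← Complex.exp_add, Complex.ofReal_cos, Complex.ofReal_sin,
    ← Complex.exp_mul_I]
  push_cast
  ring_nf

/- In terms of `φ = arg (1 - z)` one has `1 - z = 2 cos φ * exp (i φ)` and `z = -exp (2 i φ)`. -/
theorem symbol_eq (hα : α ≠ 0) (hz : ‖z‖ = 1) :
    symbol α z = (‖1 - z‖ ^ α : ℝ) • (Complex.exp (((α - 1) * (1 - z).arg : ℝ) * Complex.I) *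
      (((α - 1) * cos (1 - z).arg : ℝ) - (sin (1 - z).arg : ℝ) * Complex.I)) := by
  obtain rfl | hz1 := eq_or_ne z 1
  · simp [symbol, hα]
  have hnorm : ‖1 - z‖ = 2 * cos (1 - z).arg := by
    have h := norm_one_sub_sq_eq_two_mul_re hz
    rw [← Complex.norm_mul_cos_arg, sq, mul_left_comm] at h
    exact mul_left_cancel₀ (norm_ne_zero_iff.2 (sub_ne_zero.2 hz1.symm)) h
  have hpolar := Complex.norm_mul_exp_arg_mul_I (1 - z)
  rw [symbol, cpow_ofReal_eq_mul_exp_mul_exp]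
  generalize (1 - z).arg = φ at *
  have hE : Complex.exp (φ * Complex.I) ≠ 0 := Complex.exp_ne_zero _
  have hcos : (cos φ : ℂ) =
      (Complex.exp (φ * Complex.I) + (Complex.exp (φ * Complex.I))⁻¹) / 2 := by
    rw [Complex.ofReal_cos, Complex.cos, neg_mul, Complex.exp_neg]
  have hsin : (sin φ : ℂ) * Complex.I =
      (Complex.exp (φ * Complex.I) - (Complex.exp (φ * Complex.I))⁻¹) / 2 := by
    rw [Complex.ofReal_sin, Complex.sin, neg_mul, Complex.exp_neg, div_mul_eq_mul_div, mul_assoc,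
      Complex.I_mul_I, mul_neg_one, neg_sub]
  have hzE : z = -Complex.exp (φ * Complex.I) ^ 2 := by
    rw [hnorm, Complex.ofReal_mul, hcos] at hpolar
    field_simp at hpolar
    push_cast at hpolar
    linear_combination hpolar / 2
  rw [Complex.ofReal_mul (α - 1) (cos φ), hcos, hsin, hzE, Complex.real_smul]
  push_cast
  field_simp
  ring

theorem cos_mul_sin_mul_le (hc0 : 0 ≤ c) (hc1 : c ≤ 1) {θ : ℝ} (hθ : θ ∈ Set.Icc 0 Real.pi) :
    cos θ * sin (c * θ) ≤ c * sin θ * cos (c * θ) := by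
  set f : ℝ → ℝ := fun x => c * sin x * cos (c * x) - cos x * sin (c * x) with hf
  have hd : ∀ x, HasDerivAt f ((1 - c ^ 2) * sin x * sin (c * x)) x := fun x => by
    have hl : HasDerivAt (fun x : ℝ => c * x) c x := by simpa using (hasDerivAt_id x).const_mul c
    convert! (((Real.hasDerivAt_sin x).const_mul c).mul hl.cos).sub
      ((Real.hasDerivAt_cos x).mul hl.sin) using 1
    ring
  have hm : MonotoneOn f (Set.Icc 0 Real.pi) := by
    refine monotoneOn_of_deriv_nonneg (convex_Icc _ _)
      (fun x _ => (hd x).continuousAt.continuousWithinAt)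
      (fun x _ => (hd x).differentiableAt.differentiableWithinAt) fun x hx => ?_
    rw [interior_Icc] at hx
    rw [(hd x).deriv]
    refine mul_nonneg (mul_nonneg (by nlinarith) (Real.sin_pos_of_mem_Ioo hx).le)
      (Real.sin_nonneg_of_nonneg_of_le_pi (mul_nonneg hc0 hx.1.le) ?_)
    nlinarith [hx.1, hx.2]
  simpa [hf] using hm (Set.left_mem_Icc.2 Real.pi_pos.le) hθ hθ.1

theorem abs_mul_sin_mul_sub_le (hc0 : 0 < c) (hc1 : c ≤ 1) {φ : ℝ} (hφ : |φ| ≤ Real.pi / 2) :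
    |c * cos φ * sin (c * φ) - sin φ * cos (c * φ)| ≤
      cos (c * (Real.pi / 2)) / sin (c * (Real.pi / 2)) *
        (c * cos φ * cos (c * φ) + sin φ * sin (c * φ)) := by
  have hp := Real.pi_pos
  obtain ⟨hφ1, hφ2⟩ := abs_le.1 hφ
  have hs : 0 < sin (c * (Real.pi / 2)) :=
    Real.sin_pos_of_pos_of_lt_pi (by positivity) (by nlinarith)
  have hadd := cos_mul_sin_mul_le hc0.le hc1 (θ := φ + Real.pi / 2) ⟨by linarith, by linarith⟩
  have hsub := cos_mul_sin_mul_le hc0.le hc1 (θ := Real.pi / 2 - φ) ⟨by linarith, by linarith⟩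
  rw [Real.cos_add_pi_div_two, Real.sin_add_pi_div_two, mul_add, Real.sin_add, Real.cos_add]
    at hadd
  rw [Real.cos_pi_div_two_sub, Real.sin_pi_div_two_sub, mul_sub, Real.sin_sub, Real.cos_sub]
    at hsub
  rw [div_mul_eq_mul_div, le_div_iff₀ hs]
  nth_rw 1 [← abs_of_pos hs]
  rw [← abs_mul, abs_le]
  constructor <;> linarith

theorem exp_mul_mem_sector (hc0 : 0 < c) (hc1 : c ≤ 1) {φ : ℝ} (hφ : |φ| ≤ Real.pi / 2) :
    Complex.exp ((c * φ : ℝ) * Complex.I) * ((c * cos φ : ℝ) - (sin φ : ℝ) * Complex.I) ∈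
      sector (cos (c * (Real.pi / 2)) / sin (c * (Real.pi / 2))) := by
  have hw : Complex.exp ((c * φ : ℝ) * Complex.I) *
      ((c * cos φ : ℝ) - (sin φ : ℝ) * Complex.I) =
        ⟨c * cos φ * cos (c * φ) + sin φ * sin (c * φ),
          c * cos φ * sin (c * φ) - sin φ * cos (c * φ)⟩ := by
    apply Complex.ext <;>
      simp only [Complex.mul_re, Complex.mul_im, Complex.sub_re, Complex.sub_im,
        Complex.exp_ofReal_mul_I_re, Complex.exp_ofReal_mul_I_im, Complex.ofReal_re,
        Complex.ofReal_im, Complex.I_re, Complex.I_im] <;> ring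
  obtain ⟨hφ1, hφ2⟩ := abs_le.1 hφ
  have hcos : 0 ≤ c * cos φ * cos (c * φ) :=
    mul_nonneg (mul_nonneg hc0.le (Real.cos_nonneg_of_mem_Icc ⟨by linarith, hφ2⟩))
      (Real.cos_nonneg_of_mem_Icc ⟨by nlinarith, by nlinarith⟩)
  have hsin : 0 ≤ sin φ * sin (c * φ) := by
    obtain h | h := le_total 0 φ
    · exact mul_nonneg (Real.sin_nonneg_of_nonneg_of_le_pi h (by linarith))
        (Real.sin_nonneg_of_nonneg_of_le_pi (by positivity) (by nlinarith))
    · exact mul_nonneg_of_nonpos_of_nonpos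
        (Real.sin_nonpos_of_nonpos_of_neg_pi_le h (by linarith))
        (Real.sin_nonpos_of_nonpos_of_neg_pi_le (by nlinarith) (by nlinarith))
  rw [hw]
  exact ⟨add_nonneg hcos hsin, abs_mul_sin_mul_sub_le hc0 hc1 hφ⟩

theorem abs_tan_eq (h1 : 1 < α) (h2 : α ≤ 2) :
    |tan (α / 2 * Real.pi)| =
      cos ((α - 1) * (Real.pi / 2)) / sin ((α - 1) * (Real.pi / 2)) := by
  have hp := Real.pi_pos
  have h : α / 2 * Real.pi = (α - 1) * (Real.pi / 2) + Real.pi / 2 := by ring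
  have hc : 0 ≤ cos ((α - 1) * (Real.pi / 2)) :=
    Real.cos_nonneg_of_mem_Icc ⟨by nlinarith, by nlinarith⟩
  have hs : 0 < sin ((α - 1) * (Real.pi / 2)) :=
    Real.sin_pos_of_pos_of_lt_pi (by nlinarith) (by nlinarith)
  rw [h, Real.tan_eq_sin_div_cos, Real.sin_add_pi_div_two, Real.cos_add_pi_div_two, div_neg,
    abs_neg, abs_of_nonneg (div_nonneg hc hs.le)]

theorem symbol_mem_sector (h1 : 1 < α) (h2 : α ≤ 2) (hz : ‖z‖ = 1) :
    symbol α z ∈ sector |tan (α / 2 * Real.pi)| := by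
  have hre : 0 ≤ (1 - z).re := by simpa [hz] using Complex.re_le_norm z
  have h := exp_mul_mem_sector (c := α - 1) (by linarith) (by linarith)
    (Complex.abs_arg_le_pi_div_two_iff.2 hre)
  rw [symbol_eq (by linarith) hz, abs_tan_eq h1 h2]
  exact (sector _).smul_mem (by positivity) h

end Symbol

section Toeplitz

open AddCircle (haarAddCircle)

variable {T t α : ℝ} [Fact (0 < T)] {f : AddCircle T → ℂ}

/-- The `m × m` Toeplitz matrix generated by a function on the circle: its `(p, q)` entry is the
Fourier coefficient of index `p - q`. -/
def toeplitz (f : AddCircle T → ℂ) (m : ℕ) : Matrix (Fin m) (Fin m) ℂ :=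
  of fun p q => fourierCoeff f ((p : ℤ) - (q : ℤ))

theorem star_dotProduct_toeplitz_mulVec (hf : Integrable f haarAddCircle) {m : ℕ} (x : Fin m → ℂ) :
    star x ⬝ᵥ toeplitz f m *ᵥ x =
      ∫ s, ‖∑ q, x q * fourier (q : ℤ) s‖ ^ 2 • f s ∂haarAddCircle := by
  have hint : ∀ p q : Fin m, Integrable
      (fun s => star (x p) * x q * (fourier (-((p : ℤ) - (q : ℤ))) s • f s)) haarAddCircle :=
    fun p q => (hf.fourier_smul _).const_mul _
  have hsq : ∀ s, ‖∑ q, x q * fourier (q : ℤ) s‖ ^ 2 • f s =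
      ∑ p : Fin m, ∑ q : Fin m, star (x p) * x q * (fourier (-((p : ℤ) - (q : ℤ))) s • f s) := by
    intro s
    rw [Complex.real_smul, Complex.ofReal_pow, ← Complex.conj_mul', map_sum,
      Finset.sum_mul_sum, Finset.sum_mul]
    refine Finset.sum_congr rfl fun p _ => ?_
    rw [Finset.sum_mul]
    refine Finset.sum_congr rfl fun q _ => ?_
    rw [neg_sub, sub_eq_neg_add, fourier_add, fourier_neg, map_mul, Complex.star_def, smul_eq_mul]
    ring
  simp_rw [hsq]
  rw [integral_finsetSum _ fun p _ => integrable_finsetSum _ fun q _ => hint p q]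
  refine Finset.sum_congr rfl fun p _ => ?_
  rw [integral_finsetSum _ fun q _ => hint p q, mulVec, dotProduct, Finset.mul_sum]
  refine Finset.sum_congr rfl fun q _ => ?_
  rw [integral_const_mul, toeplitz, of_apply, fourierCoeff, Pi.star_apply]
  ring

theorem toeplitz_mem_sectorial (hf : Integrable f haarAddCircle)
    (hft : ∀ᵐ s ∂haarAddCircle, f s ∈ sector t) (m : ℕ) : toeplitz f m ∈ sectorial t := fun x => by
  have hcont : Continuous fun s : AddCircle T => ‖∑ q, x q * fourier (q : ℤ) s‖ ^ 2 := by fun_prop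
  have hint : Integrable (fun s => ‖∑ q, x q * fourier (q : ℤ) s‖ ^ 2 • f s) haarAddCircle :=
    integrableOn_univ.1
      ((integrableOn_univ.2 hf).continuousOn_smul hcont.continuousOn isCompact_univ)
  rw [star_dotProduct_toeplitz_mulVec hf]
  exact integral_mem_sector hint (hft.mono fun s hs => (sector t).smul_mem (sq_nonneg _) hs)

theorem hasSum_fourierCoeff {κ : Type*} {c : κ → ℂ} {N : κ → ℤ} {g : C(AddCircle T, ℂ)}
    (hg : HasSum (fun k => c k • fourier (N k)) g) (n : ℤ) :
    HasSum (fun k => if N k = n then c k else 0) (fourierCoeff g n) := by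
  let L : C(AddCircle T, ℂ) →L[ℂ] ℂ :=
    (innerSL ℂ (fourierBasis n)).comp (ContinuousMap.toLp 2 haarAddCircle ℂ)
  have hL : ∀ u : C(AddCircle T, ℂ), L u = fourierCoeff u n := fun u => by
    rw [← fourierCoeff_toLp, ← fourierBasis_repr, HilbertBasis.repr_apply_apply]
    rfl
  have h := hg.mapL L
  simp_rw [map_smul, hL, fourierCoeff_fourier, Pi.single_apply, smul_eq_mul, mul_ite, mul_one,
    mul_zero] at h
  simpa only [eq_comm] using h

theorem norm_fourier_apply {R : ℝ} (n : ℤ) (s : AddCircle R) : ‖fourier n s‖ = 1 := by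
  rw [fourier_apply]
  exact Circle.norm_coe _

theorem exists_continuousMap_eq_symbol (h1 : 1 ≤ α) (h2 : α ≤ 2) :
    ∃ g : C(AddCircle T, ℂ), (∀ s, g s = symbol α (fourier 1 s)) ∧
      HasSum (fun k : ℕ => -(wCoeff α k : ℂ) • (fourier ((k : ℤ) - 1) : C(AddCircle T, ℂ))) g := by
  have hsum : Summable fun k : ℕ =>
      -(wCoeff α k : ℂ) • (fourier ((k : ℤ) - 1) : C(AddCircle T, ℂ)) :=
    .of_norm (by simpa [norm_smul, fourier_norm] using summable_abs_wCoeff h1 h2)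
  refine ⟨_, fun s => ?_, hsum.hasSum⟩
  refine (ContinuousMap.hasSum_apply hsum.hasSum s).unique ?_
  convert! hasSum_symbol h1 h2 (z := fourier 1 s) (norm_fourier_apply 1 s) using 2 with k
  simp [fourier_apply, AddCircle.toCircle_zsmul]

theorem complexify_grunwaldMatrix {g : C(AddCircle T, ℂ)}
    (hg : HasSum (fun k : ℕ => -(wCoeff α k : ℂ) • (fourier ((k : ℤ) - 1) : C(AddCircle T, ℂ))) g)
    (m : ℕ) : complexify (grunwaldMatrix α m) = toeplitz g m := by
  ext p q
  have h := hasSum_fourierCoeff hg ((p : ℤ) - (q : ℤ))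
  rw [complexify_apply, toeplitz, of_apply, grunwaldMatrix, of_apply]
  split_ifs with hpq
  · have hk : ∀ k : ℕ, k ≠ (p : ℕ) + 1 - q → ¬(k : ℤ) - 1 = p - q := fun k => by omega
    rw [h.unique (hasSum_single _ fun k hne => if_neg (hk k hne)), if_pos (by omega),
      Complex.ofReal_neg]
  · have hk : ∀ k : ℕ, ¬(k : ℤ) - 1 = p - q := fun k => by omega
    rw [h.unique (hasSum_zero.congr_fun fun k => if_neg (hk k)), Complex.ofReal_zero]

theorem complexify_grunwaldMatrix_mem_sectorial (h1 : 1 < α) (h2 : α ≤ 2) (m : ℕ) :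
    complexify (grunwaldMatrix α m) ∈ sectorial |Real.tan (α / 2 * Real.pi)| := by
  obtain ⟨g, hg, hsum⟩ := exists_continuousMap_eq_symbol (T := 1) h1.le h2
  rw [complexify_grunwaldMatrix hsum]
  refine toeplitz_mem_sectorial
    (g.continuous.integrable_of_hasCompactSupport (.of_compactSpace _)) (.of_forall fun s => ?_) m
  rw [hg]
  exact symbol_mem_sector h1 h2 (norm_fourier_apply 1 s)

end Toeplitz

section Flip

variable {d m : ℕ} {n : Fin d → ℕ}

theorem flipMatrix_mul_mul_flipMatrix (A : Matrix (Fin m) (Fin m) ℝ) :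
    flipMatrix m * A * flipMatrix m = A.submatrix Fin.rev Fin.rev := by
  have hflip : ∀ p q : Fin m, flipMatrix m p q = if q = p.rev then 1 else 0 := fun p q => by
    rw [flipMatrix, of_apply]
    refine if_congr ?_ rfl rfl
    rw [Fin.ext_iff, Fin.val_rev]
    omega
  ext p q
  have hrev : ∀ x : Fin m, q = x.rev ↔ x = q.rev := fun x => by rw [eq_comm, Fin.rev_eq_iff]
  simp [mul_apply, hflip, hrev]

theorem flipMatrix_mul_self (m : ℕ) : flipMatrix m * flipMatrix m = 1 := by
  simpa [submatrix_one _ Fin.rev_injective] using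
    flipMatrix_mul_mul_flipMatrix (1 : Matrix (Fin m) (Fin m) ℝ)

theorem flipMatrix_mul_grunwaldMatrix_mul_flipMatrix (α : ℝ) (m : ℕ) :
    flipMatrix m * grunwaldMatrix α m * flipMatrix m = (grunwaldMatrix α m)ᵀ := by
  rw [flipMatrix_mul_mul_flipMatrix]
  ext p q
  simp only [grunwaldMatrix, submatrix_apply, transpose_apply, of_apply, Fin.val_rev]
  refine if_ctx_congr (by omega) (fun h => ?_) fun _ => rfl
  congr 2
  omega

theorem kron_mul_kron (A B : (i : Fin d) → Matrix (Fin (n i)) (Fin (n i)) ℝ) :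
    kron A * kron B = kron fun i => A i * B i := by
  ext p q
  simp only [kron, mul_apply, of_apply, ← Finset.prod_mul_distrib, Finset.prod_univ_sum,
    Fintype.piFinset_univ]

theorem transpose_kron (A : (i : Fin d) → Matrix (Fin (n i)) (Fin (n i)) ℝ) :
    (kron A)ᵀ = kron fun i => (A i)ᵀ := rfl

theorem kron_one : kron (fun i : Fin d => (1 : Matrix (Fin (n i)) (Fin (n i)) ℝ)) = 1 := by
  ext p q
  simp [kron, one_apply, Finset.prod_ite_zero, funext_iff]

theorem multiFlip_mul_self (n : Fin d → ℕ) : multiFlip n * multiFlip n = 1 := by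
  simp_rw [multiFlip, kron_mul_kron, flipMatrix_mul_self, kron_one]

theorem multiFlip_mul_kronAt_mul_multiFlip {i : Fin d} {B : Matrix (Fin (n i)) (Fin (n i)) ℝ}
    (hB : flipMatrix (n i) * B * flipMatrix (n i) = Bᵀ) :
    multiFlip n * kronAt i B * multiFlip n = (kronAt i B)ᵀ := by
  rw [multiFlip, kronAt, kron_mul_kron, kron_mul_kron, transpose_kron]
  congr 1
  funext j
  obtain rfl | hj := eq_or_ne j i
  · simpa using hB
  · simp [hj, flipMatrix_mul_self]

end Flip

section Scheme

variable {d : ℕ} {n : Fin d → ℕ} {α dPlus dMinus a b : Fin d → ℝ} {τ t : ℝ}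

theorem multiFlip_mul_schemeMatrix_mul_multiFlip :
    multiFlip n * schemeMatrix α dPlus dMinus a b τ n * multiFlip n =
      (schemeMatrix α dPlus dMinus a b τ n)ᵀ := by
  have hY : ∀ A : Matrix (MultiIndex n) (MultiIndex n) ℝ, multiFlip n * A * multiFlip n = Aᵀ →
      multiFlip n * Aᵀ * multiFlip n = A := fun A hA => by
    rw [← hA, ← mul_assoc, ← mul_assoc, multiFlip_mul_self, one_mul, mul_assoc,
      multiFlip_mul_self, mul_one]
  have hW := fun i => multiFlip_mul_kronAt_mul_multiFlip (n := n)
    (flipMatrix_mul_grunwaldMatrix_mul_flipMatrix (α i) (n i))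
  simp only [schemeMatrix, mul_add, add_mul, Finset.mul_sum, Finset.sum_mul, mul_smul_comm,
    smul_mul_assoc, mul_one, multiFlip_mul_self, transpose_add, transpose_sum, transpose_smul,
    transpose_one, transpose_transpose, hY _ (hW _), hW]

theorem kronAt_eq_submatrix_blockDiagonal (i : Fin d) (B : Matrix (Fin (n i)) (Fin (n i)) ℝ) :
    kronAt i B = (blockDiagonal fun _ => B).submatrix (Equiv.piSplitAt i fun j => Fin (n j))
      (Equiv.piSplitAt i fun j => Fin (n j)) := by
  ext p q
  have hne : ∀ j : {j // j ≠ i}, Function.update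
      (fun j => (1 : Matrix (Fin (n j)) (Fin (n j)) ℝ)) i B j = 1 :=
    fun j => Function.update_of_ne j.2 _ _
  simp [kronAt, kron, blockDiagonal_apply, Fintype.prod_eq_mul_prod_subtype_ne _ i, hne, one_apply,
    Finset.prod_ite_zero, funext_iff]

theorem complexify_kronAt_mem_sectorial {i : Fin d} {B : Matrix (Fin (n i)) (Fin (n i)) ℝ}
    (hB : complexify B ∈ sectorial t) : complexify (kronAt i B) ∈ sectorial t := by
  have hmap : complexify (kronAt i B) = (blockDiagonal fun _ => complexify B).submatrix
      (Equiv.piSplitAt i fun j => Fin (n j)) (Equiv.piSplitAt i fun j => Fin (n j)) := by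
    rw [kronAt_eq_submatrix_blockDiagonal]
    ext p q
    simp only [complexify_apply, submatrix_apply, blockDiagonal_apply, apply_ite Complex.ofReal,
      Complex.ofReal_zero]
  rw [hmap]
  exact submatrix_mem_sectorial _ (blockDiagonal_mem_sectorial fun _ => hB)

theorem posDef_realPart_smul_one_add {ι : Type*} [Fintype ι] [DecidableEq ι] {S : Matrix ι ι ℂ}
    {c : ℝ} (hc : 0 < c) (hS : S ∈ sectorial t) :
    (ℜ (c • 1 + S) : Matrix ι ι ℂ).PosDef := by
  rw [map_add, map_smul, AddSubgroup.coe_add, selfAdjoint.val_smul,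
    (IsSelfAdjoint.one (Matrix ι ι ℂ)).coe_realPart]
  exact (PosDef.one.smul hc).add_posSemidef (posSemidef_realPart_of_mem_sectorial hS)

theorem stepSize_pos {x y : ℝ} (hxy : x < y) (m : ℕ) : 0 < stepSize x y m :=
  div_pos (sub_pos.2 hxy) m.cast_add_one_pos

theorem skewBound_nonneg [NeZero d] (hp : ∀ i, 0 ≤ dPlus i) (hm : ∀ i, 0 ≤ dMinus i) :
    0 ≤ skewBound α dPlus dMinus :=
  Finset.le_sup'_of_le _ (Finset.mem_univ 0) <|
    mul_nonneg (div_nonneg (abs_nonneg _) (add_nonneg (hp 0) (hm 0))) (abs_nonneg _)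

theorem exists_complexify_schemeMatrix_eq [NeZero d] (hα : ∀ i, 1 < α i ∧ α i ≤ 2)
    (hp : ∀ i, 0 ≤ dPlus i) (hm : ∀ i, 0 ≤ dMinus i) (hab : ∀ i, a i < b i) (τ : ℝ)
    (n : Fin d → ℕ) :
    ∃ S ∈ sectorial (skewBound α dPlus dMinus),
      complexify (schemeMatrix α dPlus dMinus a b τ n) = (1 / τ) • 1 + S := by
  set h : Fin d → ℝ := fun i => 2 * stepSize (a i) (b i) (n i) ^ α i
  have hh : ∀ i, 0 < h i := fun i =>
    mul_pos two_pos (Real.rpow_pos_of_pos (stepSize_pos (hab i) _) _)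
  set K : Fin d → Matrix (MultiIndex n) (MultiIndex n) ℂ :=
    fun i => complexify (kronAt i (grunwaldMatrix (α i) (n i)))
  refine ⟨∑ i, ((dPlus i / h i) • K i + (dMinus i / h i) • (K i)ᴴ), ?_, ?_⟩
  · refine sum_mem fun i hi => ?_
    have hratio : |dPlus i / h i - dMinus i / h i| / (dPlus i / h i + dMinus i / h i) =
        |dPlus i - dMinus i| / (dPlus i + dMinus i) := by
      rw [← sub_div, ← add_div, abs_div, abs_of_pos (hh i), div_div_div_cancel_right₀ (hh i).ne']
    have hK := smul_add_smul_conjTranspose_mem_sectorial (div_nonneg (hp i) (hh i).le)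
      (div_nonneg (hm i) (hh i).le) (complexify_kronAt_mem_sectorial
        (complexify_grunwaldMatrix_mem_sectorial (hα i).1 (hα i).2 (n i)))
    rw [hratio] at hK
    exact sectorial_mono (Finset.le_sup' (fun i => |dPlus i - dMinus i| / (dPlus i + dMinus i) *
      |Real.tan (α i / 2 * Real.pi)|) hi) hK
  · simp_rw [schemeMatrix, map_add, map_sum, map_add, map_smul, map_one, complexify_transpose]
    rfl

end Scheme

theorem zero_le_sqrt_one_add_sq_sub_one (t : ℝ) : 0 ≤ √(1 + t ^ 2) - 1 :=
  sub_nonneg.2 (Real.one_le_sqrt.2 (by nlinarith))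

theorem sqrt_one_add_sq_sub_one_le {t : ℝ} (ht : 0 ≤ t) : √(1 + t ^ 2) - 1 ≤ t :=
  sub_le_iff_le_add.2 ((Real.sqrt_le_left (by linarith)).2 (by nlinarith))

theorem sqrt_one_add_sq_sub_one_lt {t : ℝ} (ht : 0 < t) : √(1 + t ^ 2) - 1 < t :=
  sub_lt_iff_lt_add.2 ((Real.sqrt_lt' (by linarith)).2 (by nlinarith))

end FracDiff

end

theorem mainTheorem7_general {d : ℕ} [NeZero d] {α dPlus dMinus a b : Fin d → ℝ} {τ : ℝ}
    (hα : ∀ i, 1 < α i ∧ α i ≤ 2) (hdPlus : ∀ i, 0 ≤ dPlus i) (hdMinus : ∀ i, 0 ≤ dMinus i)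
    (hab : ∀ i, a i < b i) (hτ : 0 < τ) (n : Fin d → ℕ) :
    IsUnit (FracDiff.symPart (FracDiff.schemeMatrix α dPlus dMinus a b τ n)).det ∧
      ∀ μ : ℂ,
        Module.End.HasEigenvalue
          (Matrix.toLin'
            (((FracDiff.symPart (FracDiff.schemeMatrix α dPlus dMinus a b τ n))⁻¹ *
              (FracDiff.multiFlip n * FracDiff.schemeMatrix α dPlus dMinus a b τ n)).map
              (fun x : ℝ => (x : ℂ)))) μ →
        ∃ x : ℝ, μ = (x : ℂ) ∧
          x ∈ Set.Icc (-√(1 + FracDiff.skewBound α dPlus dMinus ^ 2)) (-1) ∪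
            Set.Icc 1 √(1 + FracDiff.skewBound α dPlus dMinus ^ 2) := by
  have ht := FracDiff.skewBound_nonneg (α := α) hdPlus hdMinus
  have hτ' := one_div_pos.2 hτ
  obtain ⟨S, hS, hA⟩ := FracDiff.exists_complexify_schemeMatrix_eq hα hdPlus hdMinus hab τ n
  have hH := FracDiff.posDef_realPart_smul_one_add hτ' hS
  have hsec := add_mem (PointedCone.smul_mem _ hτ'.le (FracDiff.one_mem_sectorial ht)) hS
  rw [← hA] at hH hsec
  exact ⟨FracDiff.isUnit_det_symPart hH, fun μ hμ =>
    FracDiff.exists_real_of_hasEigenvalue_inv_symPart_mul_flip_mul hH hsec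
      (FracDiff.multiFlip_mul_self n) FracDiff.multiFlip_mul_schemeMatrix_mul_multiFlip hμ⟩

theorem mainTheorem7 (d : ℕ) [NeZero d] (α dPlus dMinus : Fin d → ℝ)
    (hα : ∀ i, 1 < α i ∧ α i < 2)
    (hdPlus : ∀ i, 0 ≤ dPlus i) (hdMinus : ∀ i, 0 ≤ dMinus i) :
    ∃ ε : ℝ, 0 ≤ ε ∧ ε ≤ FracDiff.skewBound α dPlus dMinus ∧
      (0 < FracDiff.skewBound α dPlus dMinus → ε < FracDiff.skewBound α dPlus dMinus) ∧
      ∀ (a b : Fin d → ℝ), (∀ i, a i < b i) →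
      ∀ (T : ℝ), 0 < T → ∀ (M : ℕ), 0 < M →
      ∀ (n : Fin d → ℕ), (∀ i, 0 < n i) →
        IsUnit (FracDiff.symPart
          (FracDiff.schemeMatrix α dPlus dMinus a b (T / (M : ℝ)) n)).det ∧
        ∀ μ : ℂ,
          Module.End.HasEigenvalue
            (Matrix.toLin'
              (((FracDiff.symPart (FracDiff.schemeMatrix α dPlus dMinus a b (T / (M : ℝ)) n))⁻¹ *
                (FracDiff.multiFlip n *
                  FracDiff.schemeMatrix α dPlus dMinus a b (T / (M : ℝ)) n)).map
                (fun x : ℝ => (x : ℂ)))) μ →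
          ∃ x : ℝ, μ = (x : ℂ) ∧
            x ∈ Set.Icc (-(1 + ε)) (-1) ∪ Set.Icc 1 (1 + ε) := by
  have ht := FracDiff.skewBound_nonneg (α := α) hdPlus hdMinus
  refine ⟨√(1 + FracDiff.skewBound α dPlus dMinus ^ 2) - 1,
    FracDiff.zero_le_sqrt_one_add_sq_sub_one _, FracDiff.sqrt_one_add_sq_sub_one_le ht,
    FracDiff.sqrt_one_add_sq_sub_one_lt, fun a b hab T hT M hM n _ => ?_⟩
  rw [add_sub_cancel]
  exact mainTheorem7_general (fun i => ⟨(hα i).1, (hα i).2.le⟩) hdPlus hdMinus hab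
    (div_pos hT (Nat.cast_pos.2 hM)) n
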